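/- Let $p$ be a prime and let $(R,\mathfrak m)$ be a $d$-dimensional regular local ring of characteristic $p$ that is F-finite, i.e. $R^{1/p}$ is a finitely generated $R$-module. Let $\mathfrak a\subsetneq R$ be a proper ideal of positive height, and let $\mathrm{ord}_{\mathfrak m}(\mathfrak a)$ be the largest integer $n$ with $\mathfrak a\subseteq\mathfrak m^n$. For a real number $t\ge 0$, the pair $(R,\mathfrak a^t)$ is called F-pure if for all sufficiently large $q=p^e$ there is an element $f\in\mathfrak a^{\lfloor t(q-1)\rfloor}$ such that the $R$-linear map $R\to R^{1/q}$, $1\mapsto f^{1/q}$, splits (has an $R$-linear left inverse). Let $\mathrm c(\mathfrak a)=\sup\{t\in\mathbb R_{\ge 0} : (R,\mathfrak a^t)\text{ is F-pure}\}$ be the F-pure threshold of $\mathfrak a$. Then $$\frac{1}{\mathrm{ord}_{\mathfrak m}(\mathfrak a)}\le \mathrm c(\mathfrak a)\le\frac{d}{\mathrm{ord}_{\mathfrak m}(\mathfrak a)}.$$ -/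

import Mathlib

open scoped ENNReal NNReal

/-- The `R`-module `ᵉR` (for reduced `R`, this is `R^{1/q}` with `q = p ^ e`): the additive group
of `R`, on which `R` acts through the `e`-fold iterated Frobenius, `r • x = r ^ (p ^ e) * x`. -/
def FrobeniusModule (R : Type*) (_p _e : ℕ) : Type _ := R

namespace FrobeniusModule

variable (R : Type*) [CommRing R] (p e : ℕ)

instance : AddCommGroup (FrobeniusModule R p e) := inferInstanceAs (AddCommGroup R)

/-- The element of `ᵉR` given by `d`; under `ᵉR = R^{1/q}` it is the root `d^{1/q}`. -/
def of : R ≃+ FrobeniusModule R p e := AddEquiv.refl R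

noncomputable instance [Fact p.Prime] [CharP R p] : Module R (FrobeniusModule R p e) :=
  (Module.compHom R (iterateFrobenius R p e) : Module R R)

theorem smul_of [Fact p.Prime] [CharP R p] (r x : R) :
    r • of R p e x = of R p e (r ^ (p ^ e) * x) := rfl

end FrobeniusModule

/-- `R` is F-finite: `¹R` (that is, `R^{1/p}`) is a finitely generated `R`-module. -/
def IsFFinite (R : Type*) [CommRing R] (p : ℕ) [Fact p.Prime] [CharP R p] : Prop :=
  Module.Finite R (FrobeniusModule R p 1)

/-- The `R`-linear map `R → R^{1/q}`, `r ↦ r • d^{1/q}` (with `q = p ^ e`) splits, i.e. it has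
an `R`-linear left inverse. -/
def FrobeniusSplits (R : Type*) [CommRing R] (p : ℕ) [Fact p.Prime] [CharP R p]
    (e : ℕ) (d : R) : Prop :=
  ∃ φ : FrobeniusModule R p e →ₗ[R] R,
    φ ∘ₗ LinearMap.toSpanSingleton R (FrobeniusModule R p e) (FrobeniusModule.of R p e d) =
      LinearMap.id

/-- The pair `(R, 𝔞 ^ t)` is F-pure: for all large `q = p ^ e` there is an element
`d ∈ 𝔞 ^ ⌊t (q - 1)⌋` such that `R → R^{1/q}`, `1 ↦ d^{1/q}`, splits. -/
def IsFPurePair {R : Type*} [CommRing R] (p : ℕ) [Fact p.Prime] [CharP R p]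
    (𝔞 : Ideal R) (t : ℝ≥0) : Prop :=
  ∀ᶠ e : ℕ in Filter.atTop,
    ∃ d ∈ 𝔞 ^ ⌊(t : ℝ) * ((p : ℝ) ^ e - 1)⌋₊, FrobeniusSplits R p e d

/-- The F-pure threshold `c(𝔞)`: the supremum of all real `t ≥ 0` such that `(R, 𝔞 ^ t)` is
F-pure, taken in `[0, ∞]`. -/
noncomputable def fPureThreshold {R : Type*} [CommRing R] (p : ℕ) [Fact p.Prime] [CharP R p]
    (𝔞 : Ideal R) : ℝ≥0∞ :=
  sSup {s : ℝ≥0∞ | ∃ t : ℝ≥0, s = t ∧ IsFPurePair p 𝔞 t}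

/-- The order of `𝔞` along the maximal ideal `𝔪`: the largest `n` with `𝔞 ≤ 𝔪 ^ n`
(and `∞` if there is no largest one). -/
noncomputable def idealOrder {R : Type*} [CommRing R] [IsLocalRing R] (𝔞 : Ideal R) : ℕ∞ :=
  sSup {k : ℕ∞ | ∃ n : ℕ, k = n ∧ 𝔞 ≤ IsLocalRing.maximalIdeal R ^ n}

/-!
Both bounds compare the condition "`1 ↦ g^{1/q}` splits" with membership of `g` in powers of `𝔪`.

*Upper bound.* A splitting `φ` sends `g^{1/q}` to `1`. If `𝔪` is generated by `d` elements and
`g ∈ 𝔪 ^ (d (q - 1) + 1)`, every monomial in `g` contains the `q`-th power of some generator, so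
`g^{1/q} ∈ 𝔪 R^{1/q}` and `φ` cannot reach `1` (`FrobeniusSplits.notMem_pow`). Hence F-purity of
`(R, 𝔞 ^ t)` gives `n ⌊t (q - 1)⌋ ≤ d (q - 1)` for `n = ord 𝔞` and all large `q`, and `t n ≤ d`
in the limit (`IsFPurePair.mul_le`).

*Lower bound.* `R^{1/q}` is a finite free `R`-module (`FrobeniusModule.free`), so
`1 ↦ g^{1/q}` splits as soon as `g^{1/q} ∉ 𝔪 R^{1/q}`, in particular when `g ∉ 𝔪 ^ q`. The order
function of a regular local ring satisfies `ord (f ^ k) = k ord f`, so for `f ∈ 𝔞` of order `n`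
the element `f ^ ⌊(q - 1) / n⌋` works, and `1 / n` itself is an F-pure exponent
(`isFPurePair_one_div`).

Freeness and the order formula both rest on a regular system of parameters `x` being a regular
sequence, which holds because regular local rings are domains. In a local ring regular sequences
may be permuted, hence also replaced by powers. This yields freeness of `R^{1/q}` by lifting bases
from the quotients by successive parameters, and, by cancelling factors `x i` one at a time,
`x ^ β ∉ (x i ^ (β i + 1))`. Every other monomial of degree at least `|β|` does lie in that ideal,
so a form with a unit coefficient at `x ^ β` cannot take a value of higher order
(`MvPolynomial.IsHomogeneous.eval_notMem_pow_succ`).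
-/

universe u

section

open IsLocalRing RingTheory.Sequence
open scoped Pointwise

/-! ### Regular local rings are domains -/

theorem IsLocalRing.quotient_span_singleton {R : Type u} [CommRing R] [IsLocalRing R] {x : R}
    (hx : x ∈ maximalIdeal R) : IsLocalRing (R ⧸ Ideal.span {x}) :=
  have : Nontrivial (R ⧸ Ideal.span {x}) := Ideal.Quotient.nontrivial_iff.mpr
    (((Ideal.span_singleton_le_iff_mem _).mpr hx).trans_lt
      (Ideal.IsPrime.ne_top inferInstance).lt_top).ne
  .of_surjective' _ Ideal.Quotient.mk_surjective

/-- Killing one element of the maximal ideal lowers the dimension by at most one. -/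
theorem natCast_le_ringKrullDim_quotient {R : Type u} [CommRing R] [IsLocalRing R]
    [IsNoetherianRing R] {n : ℕ} {x : R} (hx : x ∈ maximalIdeal R)
    (hn : ((n + 1 : ℕ) : WithBot ℕ∞) ≤ ringKrullDim R) :
    (n : WithBot ℕ∞) ≤ ringKrullDim (R ⧸ Ideal.span {x}) := by
  have h := ringKrullDim_le_ringKrullDim_quotient_add_card ({x} : Finset R)
    (by simpa [ringJacobson_eq_maximalIdeal] using hx)
  rw [Finset.coe_singleton, Finset.card_singleton] at h
  exact ENat.WithBot.add_le_add_natCast_right_iff.mp (by exact_mod_cast hn.trans h)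

/-- Prime avoidance: in positive dimension some element of `𝔪` avoids both `𝔪 ^ 2` and all
minimal primes. -/
theorem IsLocalRing.exists_mem_maximalIdeal_notMem_sq {R : Type u} [CommRing R] [IsLocalRing R]
    [IsNoetherianRing R] (h : 0 < ringKrullDim R) :
    ∃ x ∈ maximalIdeal R, x ∉ maximalIdeal R ^ 2 ∧ ∀ P ∈ minimalPrimes R, x ∉ P := by
  have key : ¬ ((maximalIdeal R : Set R) ⊆
      ⋃ I ∈ insert (maximalIdeal R ^ 2) (minimalPrimes R), (I : Set R)) := by
    have hsq := maximalIdeal_sq_lt_of_ringKrullDim_ne_zero h.ne'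
    rw [Ideal.subset_iUnion_iff_mem_of_isMaximal_of_finite
      ((minimalPrimes.finite_of_isNoetherianRing R).insert _) (maximalIdeal R ^ 2)
      (maximalIdeal R ^ 2)]
    · rintro (hm | hm)
      · exact hsq.ne' hm
      · rw [← maximalIdeal_height_eq_ringKrullDim, Ideal.height_eq_zero_iff.mpr hm] at h
        exact lt_irrefl _ h
    · rintro I (rfl | hI) h1 -
      · exact absurd rfl h1
      · exact hI.1.1
    · exact (hsq.trans (Ideal.IsPrime.ne_top inferInstance).lt_top).ne
    · exact (hsq.trans (Ideal.IsPrime.ne_top inferInstance).lt_top).ne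
  obtain ⟨x, hx, hx'⟩ := Set.not_subset.mp key
  simp only [Set.mem_iUnion, not_exists] at hx'
  exact ⟨x, hx, hx' _ (Set.mem_insert _ _), fun P hP => hx' P (Set.mem_insert_of_mem _ hP)⟩

/-- Exchange: an element of `𝔪 \ 𝔪 ^ 2` can replace one element of a generating family of `𝔪`,
so modulo it one generator fewer suffices. -/
theorem IsLocalRing.exists_span_quotient_eq_maximalIdeal {R : Type u} [CommRing R] [IsLocalRing R]
    {n : ℕ} {v : Fin (n + 1) → R} (hv : Ideal.span (Set.range v) = maximalIdeal R) {x : R}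
    (hx : x ∈ maximalIdeal R) (hx' : x ∉ maximalIdeal R ^ 2)
    [IsLocalRing (R ⧸ Ideal.span {x})] :
    ∃ w : Fin n → R ⧸ Ideal.span {x},
      Ideal.span (Set.range w) = maximalIdeal (R ⧸ Ideal.span {x}) := by
  have hvm : ∀ i, v i ∈ maximalIdeal R := fun i => hv ▸ Ideal.subset_span ⟨i, rfl⟩
  obtain ⟨c, hc⟩ := Ideal.mem_span_range_iff_exists_fun.mp (hv ▸ hx)
  obtain ⟨i, hi⟩ : ∃ i, c i ∉ maximalIdeal R := by
    by_contra! hall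
    refine hx' (hc ▸ Ideal.sum_mem _ fun i _ => ?_)
    rw [pow_two]
    exact Ideal.mul_mem_mul (hall i) (hvm i)
  obtain ⟨u, hu⟩ := notMem_maximalIdeal.mp hi
  have hmk : Ideal.Quotient.mk (Ideal.span {x}) x = 0 :=
    Ideal.Quotient.eq_zero_iff_mem.mpr (Ideal.mem_span_singleton_self x)
  set f := Ideal.Quotient.mk (Ideal.span {x})
  refine ⟨fun j => f (v (i.succAbove j)), ?_⟩
  rw [← map_maximalIdeal_of_surjective f Ideal.Quotient.mk_surjective, ← hv, Ideal.map_span]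
  refine le_antisymm (Ideal.span_mono ?_) (Ideal.span_le.mpr ?_)
  · rintro _ ⟨j, rfl⟩
    exact ⟨_, ⟨_, rfl⟩, rfl⟩
  · rintro _ ⟨_, ⟨k, rfl⟩, rfl⟩
    rcases Fin.eq_self_or_eq_succAbove i k with rfl | ⟨j, rfl⟩
    · rw [Fin.sum_univ_succAbove _ k] at hc
      have h1 : f (v k) = -(f ↑u⁻¹ * ∑ j, f (c (k.succAbove j)) * f (v (k.succAbove j))) := by
        have h2 : f (c k) * f (v k) = -∑ j, f (c (k.succAbove j)) * f (v (k.succAbove j)) := by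
          have h3 := congrArg f hc
          rw [hmk, map_add, map_mul, map_sum] at h3
          simpa only [eq_neg_iff_add_eq_zero, map_mul] using h3
        rw [← hu] at h2
        rw [← mul_neg, ← h2, ← mul_assoc, ← map_mul, Units.inv_mul, map_one, one_mul]
      rw [h1]
      exact neg_mem (Ideal.mul_mem_left _ _ (Ideal.sum_mem _ fun j _ =>
        Ideal.mul_mem_left _ _ (Ideal.subset_span ⟨j, rfl⟩)))
    · exact Ideal.subset_span ⟨j, rfl⟩

/-- A Noetherian local ring whose maximal ideal is generated by at most `dim R` elements is a
domain. -/
theorem IsLocalRing.isDomain_of_span_eq_maximalIdeal {n : ℕ} {R : Type u} [CommRing R]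
    [IsLocalRing R] [IsNoetherianRing R] {v : Fin n → R}
    (hv : Ideal.span (Set.range v) = maximalIdeal R) (hn : (n : WithBot ℕ∞) ≤ ringKrullDim R) :
    IsDomain R := by
  induction n generalizing R with
  | zero =>
    have : maximalIdeal R = ⊥ := by rw [← hv, Set.range_eq_empty, Ideal.span_empty]
    exact (isField_iff_maximalIdeal_eq.mpr this).isDomain
  | succ n ih =>
    obtain ⟨x, hx, hx2, hxP⟩ := exists_mem_maximalIdeal_notMem_sq (R := R)
      (lt_of_lt_of_le (by exact_mod_cast n.succ_pos) hn)
    have := quotient_span_singleton hx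
    obtain ⟨w, hw⟩ := exists_span_quotient_eq_maximalIdeal hv hx hx2
    have hdom := ih hw (natCast_le_ringKrullDim_quotient hx hn)
    have hprime : (Ideal.span {x}).IsPrime := (Ideal.Quotient.isDomain_iff_prime _).mp hdom
    obtain ⟨P, hP, hPx⟩ := Ideal.exists_minimalPrimes_le (bot_le : ⊥ ≤ Ideal.span {x})
    have hPprime : P.IsPrime := hP.1.1
    -- A minimal prime `P ⊆ (x)` with `x ∉ P` satisfies `P = xP`, so it vanishes by Nakayama.
    have hbot : P = ⊥ := by
      refine Submodule.eq_bot_of_le_smul_of_le_jacobson_bot (Ideal.span {x}) P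
        (IsNoetherian.noetherian P) (fun y hy => ?_)
        ((Ideal.span_singleton_le_iff_mem _).mpr (maximalIdeal_le_jacobson _ hx))
      obtain ⟨z, rfl⟩ := Ideal.mem_span_singleton'.mp (hPx hy)
      rw [mul_comm]
      exact Submodule.smul_mem_smul (Ideal.mem_span_singleton_self x)
        ((hPprime.mem_or_mem hy).resolve_right (hxP P hP))
    subst hbot
    exact (IsDomain.of_bot_isPrime R)

/-! ### Regular systems of parameters -/

/-- A generating system of the maximal ideal with at most `dim R` elements is a regular
sequence. -/
theorem IsLocalRing.isWeaklyRegular_of_ofList_eq_maximalIdeal {R : Type u} [CommRing R]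
    [IsLocalRing R] [IsNoetherianRing R] {rs : List R} (hrs : Ideal.ofList rs = maximalIdeal R)
    (hn : (rs.length : WithBot ℕ∞) ≤ ringKrullDim R) : IsWeaklyRegular R rs := by
  generalize hl : rs.length = n at hn
  induction n generalizing R with
  | zero =>
    rw [List.length_eq_zero_iff.mp hl]
    exact .nil R R
  | succ n ih =>
    have : IsDomain R := by
      refine isDomain_of_span_eq_maximalIdeal (v := rs.get) ?_ (hl ▸ hn)
      rw [← hrs, Set.range_list_get]
    obtain ⟨r, rs, rfl⟩ := List.exists_of_length_succ _ hl
    rw [List.length_cons, add_left_inj] at hl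
    have hr : r ∈ maximalIdeal R := hrs ▸ Ideal.subset_span (List.mem_cons_self)
    have hr0 : r ≠ 0 := by
      rintro rfl
      have h1 := ringKrullDim_le_spanFinrank_maximalIdeal R
      have h2 : (maximalIdeal R).spanFinrank ≤ n := by
        classical
        have : maximalIdeal R = Ideal.span (rs.toFinset : Set R) := by
          rw [← hrs, Ideal.ofList_cons, Ideal.span_singleton_zero, bot_sup_eq]
          simp [Ideal.ofList]
        rw [this]
        refine (Submodule.spanFinrank_span_le_ncard_of_finite (Finset.finite_toSet _)).trans ?_
        rw [Set.ncard_coe_finset, ← hl]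
        exact List.toFinset_card_le rs
      have h3 : ((n + 1 : ℕ) : WithBot ℕ∞) ≤ (n : ℕ) :=
        (hn.trans h1).trans (by exact_mod_cast h2)
      have : n + 1 ≤ n := by exact_mod_cast h3
      omega
    rw [isWeaklyRegular_cons_iff']
    refine ⟨(IsRegular.of_ne_zero hr0).left, ?_⟩
    have := quotient_span_singleton hr
    have hq := ih (R := R ⧸ Ideal.span {r}) (rs := rs.map (Ideal.Quotient.mk (Ideal.span {r})))
      (by
        rw [← map_maximalIdeal_of_surjective _ Ideal.Quotient.mk_surjective, ← hrs,
          Ideal.ofList_cons, Ideal.map_sup, Ideal.map_quotient_self, bot_sup_eq,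
          Ideal.map_ofList])
      (by simpa using hl) (natCast_le_ringKrullDim_quotient hr hn)
    have h : Ideal.span {r} = r • (⊤ : Ideal R) := by
      rw [← Submodule.ideal_span_singleton_smul, smul_eq_mul, Ideal.mul_top]
    let e : (R ⧸ Ideal.span {r}) ≃ₗ[R] QuotSMulTop r R := Submodule.quotEquivOfEq _ _ h
    exact ((e.extendScalarsOfSurjective Ideal.Quotient.mk_surjective).isWeaklyRegular_congr _).mp hq

/-! ### Powers of regular sequences and leading forms -/

/-- In a Noetherian local ring, replacing the members of a weakly regular sequence by powers
keeps it weakly regular. -/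
theorem IsLocalRing.isWeaklyRegular_map_pow {R : Type u} [CommRing R] [IsLocalRing R]
    [IsNoetherianRing R] {ι : Type*} (x : ι → R) (hx : ∀ i, x i ∈ maximalIdeal R)
    (b : ι → ℕ) (hb : ∀ i, b i ≠ 0) (l : List ι) (h : IsWeaklyRegular R (l.map x)) :
    IsWeaklyRegular R (l.map fun i => x i ^ b i) := by
  -- The last member of a regular sequence may be raised to a power; permuting the sequence
  -- brings every member into last position.
  suffices H : ∀ l l' : List ι, IsWeaklyRegular R (l.map x ++ l'.map fun i => x i ^ b i) →
      IsWeaklyRegular R ((l' ++ l).map fun i => x i ^ b i) by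
    simpa using H l [] (by simpa using h)
  clear h l
  have hxb : ∀ i, x i ^ b i ∈ maximalIdeal R :=
    fun i => Ideal.pow_mem_of_mem _ (hx i) _ (Nat.pos_of_ne_zero (hb i))
  intro l
  induction l with
  | nil => intro l' h; simpa using h
  | cons i l ih =>
    intro l' h
    have hmem : ∀ r ∈ l.map x ++ (l'.map fun i => x i ^ b i), r ∈ maximalIdeal R := by
      simp only [List.mem_append, List.mem_map]
      rintro r (⟨j, -, rfl⟩ | ⟨j, -, rfl⟩)
      exacts [hx j, hxb j]
    have h1 : IsWeaklyRegular R ((l.map x ++ l'.map fun i => x i ^ b i) ++ [x i]) :=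
      isWeaklyRegular_of_perm_of_subset_maximalIdeal h
        (List.perm_append_singleton _ _).symm
        (by simpa using ⟨hx i, by simpa using hmem⟩)
    rw [isWeaklyRegular_append_iff, isWeaklyRegular_singleton_iff] at h1
    have h2 : IsWeaklyRegular R ((l.map x ++ l'.map fun i => x i ^ b i) ++ [x i ^ b i]) := by
      rw [isWeaklyRegular_append_iff, isWeaklyRegular_singleton_iff]
      exact ⟨h1.1, h1.2.pow _⟩
    have h3 := ih (l' ++ [i]) (by simpa using h2)
    simpa using h3

/-- Each member of a weakly regular sequence is a nonzerodivisor modulo positive powers of the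
others. -/
theorem IsLocalRing.mem_span_pow_of_mul_mem {R : Type u} [CommRing R] [IsLocalRing R]
    [IsNoetherianRing R] {ι : Type*} [Fintype ι] (x : ι → R) (hx : ∀ i, x i ∈ maximalIdeal R)
    (h : IsWeaklyRegular R (Finset.univ.toList.map x)) (b : ι → ℕ) (hb : ∀ i, b i ≠ 0) (i : ι)
    {y : R} (hy : x i * y ∈ Ideal.span ((fun j => x j ^ b j) '' {i}ᶜ)) :
    y ∈ Ideal.span ((fun j => x j ^ b j) '' {i}ᶜ) := by
  classical
  have hp : (Finset.univ : Finset ι).toList.Perm ((Finset.univ.erase i).toList ++ [i]) := by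
    refine .trans ?_ (List.perm_append_singleton _ _).symm
    conv_lhs => rw [← Finset.insert_erase (Finset.mem_univ i)]
    exact Finset.toList_insert (Finset.notMem_erase i _)
  have h1 := isWeaklyRegular_of_perm_of_subset_maximalIdeal h (hp.map x) (by
    simp only [List.mem_map]
    rintro _ ⟨j, -, rfl⟩
    exact hx j)
  have h2 := isWeaklyRegular_map_pow x hx (Function.update b i 1) (by
    intro j
    by_cases hj : j = i
    · subst hj; simp
    · simpa [hj] using hb j) _ h1
  rw [List.map_append, isWeaklyRegular_append_iff] at h2
  simp only [List.map_cons, List.map_nil, Function.update_self, pow_one] at h2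
  rw [isWeaklyRegular_singleton_iff] at h2
  have hI : (Ideal.ofList ((Finset.univ.erase i).toList.map
      fun j => x j ^ Function.update b i 1 j) • ⊤ : Submodule R R) =
      Ideal.span ((fun j => x j ^ b j) '' {i}ᶜ) := by
    rw [smul_eq_mul, Ideal.mul_top]
    refine congrArg Ideal.span (Set.ext fun z => ?_)
    simp only [Set.mem_ofPred_eq, List.mem_map, Finset.mem_toList, Finset.mem_erase,
      Finset.mem_univ, and_true, Set.mem_image, Set.mem_compl_iff, Set.mem_singleton_iff]
    refine exists_congr fun j => and_congr_right fun hj => ?_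
    rw [Function.update_of_ne hj]
  rw [hI] at h2
  exact mem_of_isSMulRegular_quotient_of_smul_mem h2.2 hy

/-- The monomial `x ^ β` does not lie in the ideal generated by the powers `x i ^ (β i + 1)`. -/
theorem IsLocalRing.prod_pow_notMem_span_pow_succ {R : Type u} [CommRing R] [IsLocalRing R]
    [IsNoetherianRing R] {ι : Type*} [Fintype ι] (x : ι → R) (hx : ∀ i, x i ∈ maximalIdeal R)
    (h : IsWeaklyRegular R (Finset.univ.toList.map x)) (β : ι → ℕ) :
    ∏ i, x i ^ β i ∉ Ideal.span (Set.range fun i => x i ^ (β i + 1)) := by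
  classical
  generalize hN : ∑ i, β i = N
  induction N generalizing β with
  | zero =>
    have hβ : ∀ i, β i = 0 := by simpa using hN
    simp only [hβ, pow_zero, Finset.prod_const_one, zero_add, pow_one]
    intro hmem
    refine (Ideal.ne_top_iff_one _).mp (Ideal.IsPrime.ne_top inferInstance)
      ((Ideal.span_le.mpr ?_ : Ideal.span (Set.range x) ≤ maximalIdeal R) hmem)
    rintro _ ⟨i, rfl⟩
    exact hx i
  | succ N ih =>
    obtain ⟨i, hi⟩ : ∃ i, β i ≠ 0 := by
      by_contra! h0
      simp [h0] at hN
    -- Cancel one factor `x i` and pass to the monomial with exponent `γ = β - eᵢ`.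
    set γ := Function.update β i (β i - 1) with hγ
    have hγi : γ i + 1 = β i := by simp [hγ]; omega
    have hγj : ∀ j ≠ i, γ j = β j := fun j hj => by simp [hγ, hj]
    have hsum : ∑ j, γ j = N := by
      rw [← Finset.add_sum_erase _ _ (Finset.mem_univ i)] at hN ⊢
      have h1 : ∑ j ∈ Finset.univ.erase i, γ j = ∑ j ∈ Finset.univ.erase i, β j :=
        Finset.sum_congr rfl fun j hj => hγj j (Finset.ne_of_mem_erase hj)
      omega
    have hprod : ∏ j, x j ^ β j = x i * ∏ j, x j ^ γ j := by
      rw [← Finset.mul_prod_erase _ _ (Finset.mem_univ i),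
        ← Finset.mul_prod_erase _ (fun j => x j ^ γ j) (Finset.mem_univ i),
        Finset.prod_congr rfl fun j hj => by rw [← hγj j (Finset.ne_of_mem_erase hj)], ← hγi]
      ring
    have hsplit : ∀ δ : ι → ℕ, Set.range (fun j => x j ^ (δ j + 1)) =
        insert (x i ^ (δ i + 1)) ((fun j => x j ^ (δ j + 1)) '' {i}ᶜ) := by
      intro δ
      rw [← Set.image_univ, ← Set.image_insert_eq (f := fun j => x j ^ (δ j + 1))]
      congr 1
      ext j
      simp [em]
    intro hmem
    rw [hsplit β, hprod, Ideal.mem_span_insert] at hmem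
    obtain ⟨a, z, hz, heq⟩ := hmem
    have h1 : x i * (∏ j, x j ^ γ j - a * x i ^ (γ i + 1)) ∈
        Ideal.span ((fun j => x j ^ (β j + 1)) '' {i}ᶜ) := by
      convert! hz using 1
      rw [mul_sub, heq, hγi]
      ring
    have h2 := mem_span_pow_of_mul_mem x hx h (fun j => β j + 1) (by simp) i h1
    refine ih γ hsum ?_
    rw [hsplit γ, Ideal.mem_span_insert]
    refine ⟨a, _, ?_, (add_sub_cancel (a * x i ^ (γ i + 1)) _).symm⟩
    convert! h2 using 2
    refine Set.image_congr fun j hj => ?_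
    simp only [hγj j hj]

theorem MvPolynomial.IsHomogeneous.degree_eq_of_coeff_ne_zero {R : Type*} [CommSemiring R]
    {σ : Type*} {n : ℕ} {F : MvPolynomial σ R} (hF : F.IsHomogeneous n) {α : σ →₀ ℕ}
    (hα : F.coeff α ≠ 0) : α.degree = n := by
  rw [Finsupp.degree_eq_weight_one]
  exact hF hα

/-- The value at `x` of a form of degree `n` lies in the ideal of the powers `x i ^ (β i + 1)` as soon as
the monomial with exponent `β` does not occur in it and `|β| ≤ n`: any other exponent of degree
`n` exceeds `β` somewhere. -/
theorem MvPolynomial.IsHomogeneous.eval_mem_span_pow_succ {R : Type u} [CommRing R] {ι : Type*}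
    [Fintype ι] (x : ι → R) (β : ι →₀ ℕ) {n : ℕ} (hn : β.degree ≤ n) {F : MvPolynomial ι R}
    (hF : F.IsHomogeneous n) (hβ : F.coeff β = 0) :
    F.eval x ∈ Ideal.span (Set.range fun i => x i ^ (β i + 1)) := by
  rw [MvPolynomial.eval_eq']
  classical
  refine Ideal.sum_mem _ fun α hα => Ideal.mul_mem_left _ _ ?_
  have hαn : α.degree = n := hF.degree_eq_of_coeff_ne_zero (by simpa using hα)
  obtain ⟨i, hi⟩ : ∃ i, β i < α i := by
    by_contra! hle
    have h1 : α ≤ β := hle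
    have h2 : α = β := by
      refine le_antisymm h1 fun i => ?_
      have h3 : ∑ i, α i = ∑ i, β i := by
        have h4 : ∑ i, α i ≤ ∑ i, β i := Finset.sum_le_sum fun i _ => h1 i
        rw [Finsupp.degree_eq_sum] at hαn hn
        omega
      exact ((Finset.sum_eq_sum_iff_of_le fun i _ => h1 i).mp h3 i (Finset.mem_univ i)).ge
    subst h2
    exact (MvPolynomial.mem_support_iff.mp hα) hβ
  rw [← Finset.mul_prod_erase _ _ (Finset.mem_univ i)]
  exact Ideal.mul_mem_right _ _
    (Ideal.mem_of_dvd _ (pow_dvd_pow _ hi) (Ideal.subset_span ⟨i, rfl⟩))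

/-- Quasi-regularity of a regular system of parameters: a form of degree `n` with a coefficient
outside `𝔪` takes a value outside `𝔪 ^ (n + 1)`. -/
theorem MvPolynomial.IsHomogeneous.eval_notMem_pow_succ {R : Type u} [CommRing R] [IsLocalRing R]
    [IsNoetherianRing R] {ι : Type*} [Fintype ι] (x : ι → R)
    (hx : Ideal.span (Set.range x) = maximalIdeal R)
    (h : IsWeaklyRegular R (Finset.univ.toList.map x)) {n : ℕ} {F : MvPolynomial ι R}
    (hF : F.IsHomogeneous n) (hF0 : F.map (residue R) ≠ 0) :
    F.eval x ∉ maximalIdeal R ^ (n + 1) := by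
  classical
  intro hmem
  obtain ⟨β, hβ⟩ := MvPolynomial.ne_zero_iff.mp hF0
  rw [MvPolynomial.coeff_map] at hβ
  obtain ⟨u, hu⟩ := notMem_maximalIdeal.mp (mt (residue_eq_zero_iff _).mpr hβ)
  have hβn : β.degree = n := hF.degree_eq_of_coeff_ne_zero (fun h0 => hβ (by rw [h0, map_zero]))
  have hxm : ∀ i, x i ∈ maximalIdeal R := fun i => hx ▸ Ideal.subset_span ⟨i, rfl⟩
  set J := Ideal.span (Set.range fun i => x i ^ (β i + 1))
  have hpow : maximalIdeal R ^ (n + 1) ≤ J := by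
    intro y hy
    rw [← hx, Ideal.mem_span_pow_iff_exists_isHomogeneous] at hy
    obtain ⟨G, hG, rfl⟩ := hy
    refine hG.eval_mem_span_pow_succ x β (by omega) (hG.coeff_eq_zero ?_)
    omega
  have hrest : (F - MvPolynomial.monomial β (F.coeff β)).eval x ∈ J := by
    refine MvPolynomial.IsHomogeneous.eval_mem_span_pow_succ x β hβn.le
      (hF.sub (MvPolynomial.isHomogeneous_monomial _ hβn)) ?_
    simp
  rw [map_sub, MvPolynomial.eval_monomial, ← hu] at hrest
  have h1 : (u : R) * β.prod (fun i k => x i ^ k) ∈ J :=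
    (Submodule.sub_mem_iff_right _ (hpow hmem)).mp hrest
  rw [Ideal.unit_mul_mem_iff_mem _ u.isUnit, Finsupp.prod_fintype _ _ (by simp)] at h1
  exact prod_pow_notMem_span_pow_succ x hxm h β h1

/-- In a regular local ring `ord (f ^ k) = k ord f`, because the leading form of `f` lives in a
polynomial ring over the residue field, which is a domain. -/
theorem IsLocalRing.pow_notMem_maximalIdeal_pow {R : Type u} [CommRing R] [IsLocalRing R]
    [IsNoetherianRing R] {ι : Type*} [Fintype ι] (x : ι → R)
    (hx : Ideal.span (Set.range x) = maximalIdeal R)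
    (h : IsWeaklyRegular R (Finset.univ.toList.map x)) {n : ℕ} {f : R}
    (hf : f ∈ maximalIdeal R ^ n) (hf' : f ∉ maximalIdeal R ^ (n + 1)) (k : ℕ) :
    f ^ k ∉ maximalIdeal R ^ (n * k + 1) := by
  rw [← hx, Ideal.mem_span_pow_iff_exists_isHomogeneous] at hf
  obtain ⟨F, hF, rfl⟩ := hf
  have hxm : ∀ i, x i ∈ maximalIdeal R := fun i => hx ▸ Ideal.subset_span ⟨i, rfl⟩
  have hF0 : F.map (residue R) ≠ 0 := by
    intro h0
    refine hf' ?_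
    rw [MvPolynomial.eval_eq']
    refine Ideal.sum_mem _ fun α hα => ?_
    have hαn : α.degree = n := hF.degree_eq_of_coeff_ne_zero (by simpa using hα)
    rw [pow_succ']
    refine Ideal.mul_mem_mul ?_ ?_
    · rw [← residue_eq_zero_iff, ← MvPolynomial.coeff_map, h0, MvPolynomial.coeff_zero]
    · rw [← hαn, Finsupp.degree_eq_sum, ← Finset.prod_pow_eq_pow_sum]
      exact Ideal.prod_mem_prod fun i _ => Ideal.pow_mem_pow (hxm i) _
  rw [← map_pow]
  refine (hF.pow k).eval_notMem_pow_succ x hx h ?_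
  rw [map_pow]
  exact pow_ne_zero k hF0

/-! ### Freeness of the Frobenius module -/

/-- A finite module over a Noetherian local ring is free if some sequence generating the maximal
ideal is weakly regular on it. -/
theorem IsLocalRing.free_of_isWeaklyRegular {R : Type u} [CommRing R] [IsLocalRing R]
    [IsNoetherianRing R] {rs : List R} (hrs : Ideal.ofList rs = maximalIdeal R)
    {M : Type*} [AddCommGroup M] [Module R M] [Module.Finite R M] (h : IsWeaklyRegular M rs) :
    Module.Free R M := by
  generalize hl : rs.length = n
  induction n generalizing R M with
  | zero =>
    obtain rfl := List.length_eq_zero_iff.mp hl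
    let := (isField_iff_maximalIdeal_eq.mpr (hrs.symm.trans Ideal.ofList_nil)).toField
    exact Module.Free.of_divisionRing R M
  | succ n ih =>
    obtain ⟨r, rs, rfl⟩ := List.exists_of_length_succ _ hl
    rw [List.length_cons, add_left_inj] at hl
    have hr : r ∈ maximalIdeal R := hrs ▸ Ideal.subset_span (List.mem_cons_self)
    rw [isWeaklyRegular_cons_iff'] at h
    have := quotient_span_singleton hr
    have : Module.Finite (R ⧸ Ideal.span {r}) (QuotSMulTop r M) :=
      Module.Finite.of_restrictScalars_finite R _ _
    have := Module.finitePresentation_of_finite R M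
    rw [← Module.free_quotSMulTop_iff_free R M (maximalIdeal_le_jacobson _ hr) h.1]
    refine ih (rs := rs.map (Ideal.Quotient.mk (Ideal.span {r}))) ?_ h.2 (by simpa using hl)
    rw [← map_maximalIdeal_of_surjective _ Ideal.Quotient.mk_surjective, ← hrs,
      Ideal.ofList_cons, Ideal.map_sup, Ideal.map_quotient_self, bot_sup_eq, Ideal.map_ofList]

/-- In a finite free module over a local ring, an element outside `𝔪 M` is mapped to `1` by some
linear form. -/
theorem IsLocalRing.exists_linearMap_apply_eq_one {R : Type*} [CommRing R] [IsLocalRing R]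
    {M : Type*} [AddCommGroup M] [Module R M] [Module.Finite R M] [Module.Free R M] {m : M}
    (hm : m ∉ maximalIdeal R • (⊤ : Submodule R M)) : ∃ φ : M →ₗ[R] R, φ m = 1 := by
  let b := Module.Free.chooseBasis R M
  obtain ⟨i, hi⟩ : ∃ i, b.repr m i ∉ maximalIdeal R := by
    by_contra! hall
    refine hm ?_
    rw [← b.sum_repr m]
    exact Submodule.sum_mem _ fun i _ => Submodule.smul_mem_smul (hall i) trivial
  obtain ⟨u, hu⟩ := notMem_maximalIdeal.mp hi
  refine ⟨(↑u⁻¹ : R) • b.coord i, ?_⟩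
  rw [LinearMap.smul_apply, b.coord_apply, ← hu, smul_eq_mul, Units.inv_mul]

variable {R : Type u} [CommRing R] {p : ℕ} [Fact p.Prime] [CharP R p]

/-- All iterates of the Frobenius of an F-finite ring are finite. -/
theorem IsFFinite.finite_frobeniusModule (hF : IsFFinite R p) (e : ℕ) :
    Module.Finite R (FrobeniusModule R p e) := by
  have h1 : (iterateFrobenius R p 1).Finite := hF
  suffices h : (iterateFrobenius R p e).Finite from h
  induction e with
  | zero =>
    rw [iterateFrobenius_zero]
    exact RingHom.Finite.id R
  | succ e ih =>
    rw [iterateFrobenius_add]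
    exact ih.comp h1

/-- The sequence `rs` is weakly regular on `ᵉR` when the sequence of `q`-th powers is weakly
regular on `R`, where `q = p ^ e`. -/
theorem FrobeniusModule.isWeaklyRegular {rs : List R} {e : ℕ}
    (h : IsWeaklyRegular R (rs.map (· ^ p ^ e))) : IsWeaklyRegular (FrobeniusModule R p e) rs := by
  refine ((FrobeniusModule.of R p e).symm.isWeaklyRegular_congr ?_).mpr h
  rw [List.forall₂_map_right_iff, List.forall₂_same]
  exact fun r _ x => rfl

/-- The submodule `𝔪 • ᵉR` lies in the image of `𝔪 ^ q`, where `q = p ^ e`, since `r ∈ 𝔪` acts as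
multiplication by `r ^ q`. -/
theorem FrobeniusModule.of_notMem_smul_top [IsLocalRing R] {e : ℕ} {g : R}
    (hg : g ∉ maximalIdeal R ^ p ^ e) :
    of R p e g ∉ maximalIdeal R • (⊤ : Submodule R (FrobeniusModule R p e)) := by
  intro hmem
  refine hg ?_
  have : ∀ y ∈ maximalIdeal R • (⊤ : Submodule R (FrobeniusModule R p e)),
      (of R p e).symm y ∈ maximalIdeal R ^ p ^ e := by
    intro y hy
    refine Submodule.smul_induction_on hy (fun r hr x _ => ?_) (fun x y hx hy => ?_)
    · exact Ideal.mul_mem_right _ _ (Ideal.pow_mem_pow hr _)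
    · rw [map_add]
      exact add_mem hx hy
  exact this _ hmem

/-- A splitting of `1 ↦ g^{1/q}` exists when `ᵉR` is finite free and `g ∉ 𝔪 ^ q`. -/
theorem frobeniusSplits_of_notMem_pow [IsLocalRing R] {e : ℕ}
    [Module.Finite R (FrobeniusModule R p e)] [Module.Free R (FrobeniusModule R p e)] {g : R}
    (hg : g ∉ maximalIdeal R ^ p ^ e) : FrobeniusSplits R p e g := by
  obtain ⟨φ, hφ⟩ := exists_linearMap_apply_eq_one (FrobeniusModule.of_notMem_smul_top (p := p) hg)
  refine ⟨φ, LinearMap.ext_ring ?_⟩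
  simpa using hφ

/-- Pigeonhole: with `s` generators of `𝔪`, every monomial of degree greater than `s (q - 1)` is
divisible by a `q`-th power of a generator, so no splitting exists for `g ∈ 𝔪 ^ (s (q - 1) + 1)`. -/
theorem FrobeniusSplits.notMem_pow [IsLocalRing R] {s : ℕ} {x : Fin s → R}
    (hx : Ideal.span (Set.range x) = maximalIdeal R) {e : ℕ} {g : R}
    (hg : FrobeniusSplits R p e g) : g ∉ maximalIdeal R ^ (s * (p ^ e - 1) + 1) := by
  obtain ⟨φ, hφ⟩ := hg
  have h1 : φ (FrobeniusModule.of R p e g) = 1 := by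
    simpa using LinearMap.congr_fun hφ 1
  have hq : 0 < p ^ e := pow_pos (Fact.out : p.Prime).pos e
  intro hmem
  rw [← hx, Ideal.mem_span_pow_iff_exists_isHomogeneous] at hmem
  obtain ⟨F, hF, rfl⟩ := hmem
  refine (Ideal.ne_top_iff_one _).mp (Ideal.IsPrime.ne_top inferInstance :
    maximalIdeal R ≠ ⊤) ?_
  rw [← h1, MvPolynomial.eval_eq', map_sum, map_sum]
  refine Ideal.sum_mem _ fun α hα => ?_
  have hαn := hF.degree_eq_of_coeff_ne_zero (by simpa using hα)
  obtain ⟨i, hi⟩ : ∃ i, p ^ e ≤ α i := by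
    by_contra! hlt
    have h2 : ∑ i, α i ≤ ∑ _i : Fin s, (p ^ e - 1) :=
      Finset.sum_le_sum fun i _ => Nat.le_sub_one_of_lt (hlt i)
    rw [Finsupp.degree_eq_sum] at hαn
    simp only [Finset.sum_const, Finset.card_univ, Fintype.card_fin, smul_eq_mul] at h2
    omega
  obtain ⟨y, hy⟩ : x i ^ p ^ e ∣ F.coeff α * ∏ j, x j ^ α j :=
    ((pow_dvd_pow _ hi).trans (Finset.dvd_prod_of_mem (fun j => x j ^ α j)
      (Finset.mem_univ i))).mul_left _
  rw [hy, ← FrobeniusModule.smul_of, map_smul]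
  exact Ideal.mul_mem_right _ _ (hx ▸ Ideal.subset_span ⟨i, rfl⟩)

/-! ### The order of an ideal and the F-pure threshold -/

/-- By Krull's intersection theorem the order of a nonzero proper ideal is a positive integer. -/
theorem exists_idealOrder_eq {R : Type*} [CommRing R] [IsLocalRing R] [IsNoetherianRing R]
    {𝔞 : Ideal R} (htop : 𝔞 ≠ ⊤) (hbot : 𝔞 ≠ ⊥) :
    ∃ n : ℕ, 0 < n ∧ idealOrder 𝔞 = n ∧ 𝔞 ≤ maximalIdeal R ^ n ∧
      ¬ 𝔞 ≤ maximalIdeal R ^ (n + 1) := by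
  classical
  have hex : ∃ k, ¬ 𝔞 ≤ maximalIdeal R ^ k := by
    by_contra! hall
    refine hbot (le_bot_iff.mp ?_)
    rw [← Ideal.iInf_pow_eq_bot_of_isLocalRing (maximalIdeal R)
      (Ideal.IsPrime.ne_top inferInstance)]
    exact le_iInf hall
  have h1 : 1 < Nat.find hex := by
    rw [Nat.lt_find_iff]
    intro k hk
    interval_cases k
    · simp
    · simpa using le_maximalIdeal htop
  obtain ⟨n, hn⟩ : ∃ n, Nat.find hex = n + 1 := ⟨Nat.find hex - 1, by omega⟩
  have hle : 𝔞 ≤ maximalIdeal R ^ n := not_not.mp (Nat.find_min hex (by omega))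
  have hnot : ¬ 𝔞 ≤ maximalIdeal R ^ (n + 1) := hn ▸ Nat.find_spec hex
  refine ⟨n, by omega, le_antisymm (sSup_le ?_) (le_sSup ⟨n, rfl, hle⟩), hle, hnot⟩
  rintro _ ⟨k, rfl, hk⟩
  by_contra! hlt
  exact hnot (hk.trans (Ideal.pow_le_pow_right (by exact_mod_cast hlt)))

/-- Freeness part of Kunz's theorem: `q`-th powers of a regular system of parameters form a regular
sequence, so the parameters themselves are regular on `ᵉR`, which is then free. -/
theorem FrobeniusModule.free [IsLocalRing R] [IsNoetherianRing R] {ι : Type*} [Fintype ι]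
    {x : ι → R} (hx : Ideal.span (Set.range x) = maximalIdeal R)
    (h : IsWeaklyRegular R (Finset.univ.toList.map x)) (e : ℕ)
    [Module.Finite R (FrobeniusModule R p e)] : Module.Free R (FrobeniusModule R p e) := by
  refine free_of_isWeaklyRegular (rs := Finset.univ.toList.map x)
    (by rw [← hx]; simp [Ideal.ofList, Set.range]) (FrobeniusModule.isWeaklyRegular ?_)
  simpa [Function.comp_def] using isWeaklyRegular_map_pow x
    (fun i => hx ▸ Ideal.subset_span ⟨i, rfl⟩) (fun _ => p ^ e)
    (fun _ => pow_ne_zero _ (Fact.out : p.Prime).ne_zero) _ h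

/-- If `𝔞` has order `n`, then `(R, 𝔞 ^ (1 / n))` is F-pure: for `f ∈ 𝔞` of order `n`, the power
`f ^ k` with `k = ⌊(q - 1) / n⌋` has order `n k < q`, hence avoids `𝔪 ^ q`. -/
theorem isFPurePair_one_div [IsLocalRing R] [IsNoetherianRing R] (hF : IsFFinite R p)
    {s : ℕ} {x : Fin s → R} (hx : Ideal.span (Set.range x) = maximalIdeal R)
    (h : IsWeaklyRegular R (Finset.univ.toList.map x)) {𝔞 : Ideal R} {n : ℕ}
    (hle : 𝔞 ≤ maximalIdeal R ^ n) (hnot : ¬ 𝔞 ≤ maximalIdeal R ^ (n + 1)) :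
    IsFPurePair p 𝔞 (1 / n) := by
  obtain ⟨f, hfa, hf⟩ := Set.not_subset.mp hnot
  refine Filter.Eventually.of_forall fun e => ⟨_, Ideal.pow_mem_pow hfa _, ?_⟩
  have := hF.finite_frobeniusModule e
  have := FrobeniusModule.free (p := p) hx h e
  refine frobeniusSplits_of_notMem_pow
    (mt (fun hm => Ideal.pow_le_pow_right ?_ hm)
      (pow_notMem_maximalIdeal_pow x hx h (hle hfa) hf _))
  have hq : 1 ≤ p ^ e := Nat.one_le_pow _ _ (Fact.out : p.Prime).pos
  have hfloor : ⌊((1 / n : ℝ≥0) : ℝ) * ((p : ℝ) ^ e - 1)⌋₊ = (p ^ e - 1) / n := by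
    rw [← Nat.floor_div_eq_div (K := ℝ)]
    congr 1
    push_cast [Nat.cast_sub hq]
    ring
  rw [hfloor]
  have := Nat.mul_div_le (p ^ e - 1) n
  omega

/-- F-purity of `(R, 𝔞 ^ t)` with `𝔞 ⊆ 𝔪 ^ n` and `𝔪` generated by `s` elements forces
`t n ≤ s`. -/
theorem IsFPurePair.mul_le [IsLocalRing R] {s : ℕ} {x : Fin s → R}
    (hx : Ideal.span (Set.range x) = maximalIdeal R) {𝔞 : Ideal R} {n : ℕ}
    (hle : 𝔞 ≤ maximalIdeal R ^ n) {t : ℝ≥0} (ht : IsFPurePair p 𝔞 t) : t * n ≤ s := by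
  have hbound : ∀ᶠ e : ℕ in Filter.atTop, ((t : ℝ) * n - s) * ((p : ℝ) ^ e - 1) ≤ n := by
    filter_upwards [ht] with e he
    obtain ⟨g, hga, hg⟩ := he
    set k := ⌊(t : ℝ) * ((p : ℝ) ^ e - 1)⌋₊
    have hg1 : g ∈ maximalIdeal R ^ (n * k) := by
      rw [pow_mul]
      exact Ideal.pow_right_mono hle k hga
    have hk : n * k ≤ s * (p ^ e - 1) := by
      by_contra! hlt
      exact hg.notMem_pow hx (Ideal.pow_le_pow_right hlt hg1)
    have hq : 1 ≤ p ^ e := Nat.one_le_pow _ _ (Fact.out : p.Prime).pos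
    have hk' : (n : ℝ) * k ≤ s * ((p : ℝ) ^ e - 1) := by
      have : ((n * k : ℕ) : ℝ) ≤ (s * (p ^ e - 1) : ℕ) := by exact_mod_cast hk
      push_cast [Nat.cast_sub hq] at this
      exact this
    have hfl : (n : ℝ) * (t * ((p : ℝ) ^ e - 1)) ≤ n * (k + 1) :=
      mul_le_mul_of_nonneg_left (Nat.lt_floor_add_one _).le n.cast_nonneg
    linarith
  rw [← NNReal.coe_le_coe]
  push_cast
  by_contra! hlt
  have hp : (1 : ℝ) < p := by exact_mod_cast (Fact.out : p.Prime).one_lt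
  have hlim : Filter.Tendsto (fun e : ℕ => ((t : ℝ) * n - s) * ((p : ℝ) ^ e - 1))
      Filter.atTop Filter.atTop :=
    (Filter.tendsto_atTop_add_const_right _ (-1)
      (tendsto_pow_atTop_atTop_of_one_lt hp)).const_mul_atTop (sub_pos.mpr hlt)
  obtain ⟨e, h1, h2⟩ := (hbound.and (hlim.eventually_gt_atTop (n : ℝ))).exists
  exact absurd h1 h2.not_ge

end

theorem mainTheorem10 (R : Type*) [CommRing R] [IsRegularLocalRing R]
    (p : ℕ) [Fact p.Prime] [CharP R p] (hF : IsFFinite R p)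
    (d : ℕ) (hd : ringKrullDim R = d)
    (𝔞 : Ideal R) (hproper : 𝔞 ≠ ⊤) (hheight : 0 < 𝔞.height) :
    1 / (idealOrder 𝔞 : ℝ≥0∞) ≤ fPureThreshold p 𝔞 ∧
      fPureThreshold p 𝔞 ≤ (d : ℝ≥0∞) / (idealOrder 𝔞 : ℝ≥0∞) := by
  have hbot : 𝔞 ≠ ⊥ := by
    rintro rfl
    rw [Ideal.height_bot] at hheight
    exact lt_irrefl _ hheight
  obtain ⟨n, hn, hord, hle, hnot⟩ := exists_idealOrder_eq hproper hbot
  -- A minimal generating set of `𝔪` has `d` elements.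
  obtain ⟨x, hx⟩ : ∃ x : Fin d → R, Ideal.span (Set.range x) = IsLocalRing.maximalIdeal R := by
    obtain ⟨S, hS, hspan⟩ := Submodule.FG.exists_span_finset_card_eq_spanFinrank
      (IsLocalRing.maximalIdeal R).fg_of_isNoetherianRing
    have hSd : S.card = d := by
      have h1 := IsRegularLocalRing.spanFinrank_maximalIdeal (R := R)
      rw [hd, ← hS] at h1
      exact_mod_cast h1
    refine ⟨fun i => (S.equivFinOfCardEq hSd).symm i, ?_⟩
    rw [← hspan]
    refine congrArg Ideal.span ?_
    rw [show (fun i => ((S.equivFinOfCardEq hSd).symm i : R)) =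
      Subtype.val ∘ (S.equivFinOfCardEq hSd).symm from rfl, EquivLike.range_comp]
    simp
  have hreg : RingTheory.Sequence.IsWeaklyRegular R (Finset.univ.toList.map x) :=
    IsLocalRing.isWeaklyRegular_of_ofList_eq_maximalIdeal
      (by rw [← hx]; simp [Ideal.ofList, Set.range]) (by simp [hd])
  have hcast : (idealOrder 𝔞 : ℝ≥0∞) = n := by rw [hord]; rfl
  have hn0 : (n : ℝ≥0) ≠ 0 := by exact_mod_cast hn.ne'
  rw [hcast]
  refine ⟨le_sSup ⟨1 / n, ?_, isFPurePair_one_div hF hx hreg hle hnot⟩, sSup_le ?_⟩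
  · rw [ENNReal.coe_div hn0]
    simp
  · rintro _ ⟨t, rfl, ht⟩
    rw [ENNReal.le_div_iff_mul_le (.inl (by exact_mod_cast hn.ne')) (.inl (by simp))]
    exact_mod_cast ht.mul_le hx hle
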